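/- All graphs are undirected without multiple edges; loops are allowed. A walk of length $m$ in a graph $G$ is a sequence of vertices $(v_0v_1\cdots v_m)$ with consecutive vertices adjacent, i.e. a graph homomorphism $P_m\to G$ from the path with vertices $0,\dots,m$; $\alpha * \alpha'$ denotes concatenation and $\alpha^{-1}$ the reversed walk. Two walks of length $m$ from $x$ to $y$ are homotopic rel endpoints if for some $r$ there is a graph homomorphism $\Lambda: P_m\times I_r\to G$, where $\times$ is the categorical product and $I_r$ is the path with vertices $0,\dots,r$ with a loop added at every vertex, such that $\Lambda(\cdot,0)$ and $\Lambda(\cdot,r)$ are the two walks, $\Lambda(0,j)=x$ and $\Lambda(m,j)=y$ for all $j$. A prune of a walk replaces a segment $(\cdots v\,w\,v\cdots)$ by $(\cdots v\cdots)$. The fundamental groupoid $\Pi(G)$ has the vertices of $G$ as objects, and as arrows from $x$ to $y$ the classes of walks from $x$ to $y$ under the equivalence relation generated by homotopy rel endpoints and prunes, composed by concatenation. The fundamental group $\Pi_v^v(G)$ is its isotropy group at the vertex $v$. A 3-cycle at a vertex $x$ is a closed walk $(x\,w_2\,w_3\,x)$ with $x,w_2,w_3$ distinct. The Kneser graph $K(n,2)$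 has as vertices the 2-element subsets of $\{1,\dots,n\}$, two of them being adjacent when they are disjoint. **Proposition.** Let $n\ge 6$. For every vertex $v$ of $K(n,2)$: 1. $\Pi_v^v(K(n,2))\cong\mathbb{Z}/2$. 2. $\Pi_v^v(K(n,2))$ is generated by the classes of the circuits $P*C*P^{-1}$, where $P$ is a walk starting at $v$ and $C$ is a 3-cycle at the end of $P$. 3. If $k\ge 1$, $P=(v\cdots v_{k-1}v_k)$ is a walk starting at $v$, $Q=(v\cdots v_{k-1})$ is $P$ without its last edge, and $C$ is a 3-cycle at $v_k$, then there is a 3-cycle $C'$ at $v_{k-1}$ such that $P*C*P^{-1}$ and $Q*C'*Q^{-1}$ represent the same element of $\Pi_v^v(K(n,2))$. 4. $\Pi_v^v(K(n,2))$ is generated by the classes of the 3-cycles $(v\,w_2\,w_3\,v)$ at $v$. Moreover, for $v=\{1,2\}$ let $\beta=(\{1,2\}\{3,4\}\{1,5\}\{2,3\}\{4,5\}\{1,2\})$, a 5-cycle in the Petersen graph $K(5,2)\subseteq K(n,2)$. Then every 3-cycle at $v$ represents the same element of $\Pi_v^v(K(n,2))$ as $\beta$, and $\beta=\beta^{-1}$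 in $\Pi_v^v(K(n,2))$. -/

import Mathlib

open CategoryTheory

universe u w

/-- An undirected graph without multiple edges on the vertex set `V`; loops are allowed. -/
structure Gph (V : Type u) where
  Adj : V → V → Prop
  symm : ∀ {a b : V}, Adj a b → Adj b a

namespace Gph

variable {V : Type u} {W : Type w}

/-- Graph homomorphisms: vertex maps preserving adjacency. -/
structure Hom (G : Gph V) (H : Gph W) where
  toFun : V → W
  map_adj : ∀ {a b : V}, G.Adj a b → H.Adj (toFun a) (toFun b)

/-- The categorical product of graphs. -/
def prod (G : Gph V) (H : Gph W) : Gph (V × W) where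
  Adj a b := G.Adj a.1 b.1 ∧ H.Adj a.2 b.2
  symm h := ⟨G.symm h.1, H.symm h.2⟩

/-- The (unlooped) path graph of length `n`, with vertices `0, …, n`. -/
def path (n : ℕ) : Gph (Fin (n + 1)) where
  Adj i j := i.val + 1 = j.val ∨ j.val + 1 = i.val
  symm h := h.symm

/-- The looped path graph of length `n`, with vertices `0, …, n`, each of which has a loop. -/
def loopedPath (n : ℕ) : Gph (Fin (n + 1)) where
  Adj i j := i = j ∨ i.val + 1 = j.val ∨ j.val + 1 = i.val
  symm h := by
    rcases h with h | h | h
    · exact Or.inl h.symm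
    · exact Or.inr (Or.inr h)
    · exact Or.inr (Or.inl h)

/-- Walks in a graph. `cons h p` is the walk that traverses the edge `h` first and then `p`. -/
inductive Walk (G : Gph V) : V → V → Type u
  | nil (v : V) : Walk G v v
  | cons {a b c : V} (h : G.Adj a b) (p : Walk G b c) : Walk G a c

namespace Walk

variable {G : Gph V}

/-- The number of edges of a walk. -/
def length : {a b : V} → G.Walk a b → ℕ
  | _, _, nil _ => 0
  | _, _, cons _ p => p.length + 1

/-- The `i`-th vertex of a walk (the last vertex if `i` exceeds the length). -/
def getVert : {a b : V} → G.Walk a b → ℕ → V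
  | _, _, nil v, _ => v
  | a, _, cons _ _, 0 => a
  | _, _, cons _ p, i + 1 => p.getVert i

/-- Concatenation of walks. -/
def append : {a b c : V} → G.Walk a b → G.Walk b c → G.Walk a c
  | _, _, _, nil _, q => q
  | _, _, _, cons h p, q => cons h (p.append q)

/-- The walk consisting of a single edge. -/
def edge {a b : V} (h : G.Adj a b) : G.Walk a b := cons h (nil b)

/-- The walk traversed backwards. -/
def reverse : {a b : V} → G.Walk a b → G.Walk b a
  | _, _, nil v => nil v
  | _, _, cons h p => p.reverse.append (edge (G.symm h))

/-- A 3-cycle `(v w₂ w₃ v)` based at `v`: a closed walk of length 3 with `v, w₂, w₃` distinct. -/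
def IsThreeCycle {v : V} (C : G.Walk v v) : Prop :=
  C.length = 3 ∧ C.getVert 0 ≠ C.getVert 1 ∧ C.getVert 0 ≠ C.getVert 2 ∧
    C.getVert 1 ≠ C.getVert 2

/-- Homotopy rel endpoints: a graph homomorphism `P_n × I_m → G` from the product of the path of
length `n` with a looped path that restricts to the two given walks of length `n` at the two ends of
`I_m` and has all its intermediate walks running from `a` to `b`. -/
def RelHomotopic {a b : V} (p q : G.Walk a b) : Prop :=
  ∃ n m : ℕ, p.length = n ∧ q.length = n ∧
    ∃ F : Hom ((path n).prod (loopedPath m)) G,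
      (∀ i : Fin (n + 1), F.toFun (i, 0) = p.getVert i) ∧
      (∀ i : Fin (n + 1), F.toFun (i, Fin.last m) = q.getVert i) ∧
      (∀ j : Fin (m + 1), F.toFun (0, j) = a) ∧
      (∀ j : Fin (m + 1), F.toFun (Fin.last n, j) = b)

/-- `Prune α α'`: the walk `α = (… v w v …)` and `α' = (… v …)` is obtained from it by deleting one
consecutive pair `v, w`. -/
inductive Prune : {a b : V} → G.Walk a b → G.Walk a b → Prop
  | mk {a v x b : V} (p : G.Walk a v) (h : G.Adj v x) (h' : G.Adj x v) (q : G.Walk v b) :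
      Prune (p.append (cons h (cons h' q))) (p.append q)

/-- The moves that generate the equivalence of walks. -/
def Move {a b : V} (p q : G.Walk a b) : Prop := RelHomotopic p q ∨ Prune p q

/-! ### Basic facts that make concatenation of classes of walks well defined -/

theorem append_nil {a b : V} (p : G.Walk a b) : p.append (nil b) = p := by
  induction p with
  | nil => rfl
  | cons h p ih => simp [append, ih]

theorem append_assoc {a b c d : V} (p : G.Walk a b) (q : G.Walk b c) (r : G.Walk c d) :
    (p.append q).append r = p.append (q.append r) := by
  induction p with
  | nil => rfl
  | cons h p ih => simp [append, ih]

theorem length_append {a b c : V} (p : G.Walk a b) (q : G.Walk b c) :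
    (p.append q).length = p.length + q.length := by
  induction p with
  | nil => simp [append, length]
  | cons h p ih => simp [append, length, ih]; omega

theorem length_reverse {a b : V} (p : G.Walk a b) : p.reverse.length = p.length := by
  induction p with
  | nil => rfl
  | cons h p ih => simp [reverse, length_append, length, edge, ih]

theorem reverse_append {a b c : V} (p : G.Walk a b) (q : G.Walk b c) :
    (p.append q).reverse = q.reverse.append p.reverse := by
  induction p with
  | nil => simp [append, reverse, append_nil]
  | cons h p ih => simp [append, reverse, ih, append_assoc]

theorem reverse_reverse {a b : V} (p : G.Walk a b) : p.reverse.reverse = p := by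
  induction p with
  | nil => rfl
  | cons h p ih => simp [reverse, reverse_append, ih, edge, append]

theorem getVert_zero {a b : V} (p : G.Walk a b) : p.getVert 0 = a := by
  cases p <;> rfl

theorem getVert_append {a b c : V} (p : G.Walk a b) (q : G.Walk b c) (i : ℕ) :
    (p.append q).getVert i = if i < p.length then p.getVert i else q.getVert (i - p.length) := by
  induction p generalizing i with
  | nil => simp [append, length]
  | cons h p ih =>
    cases i with
    | zero => simp [append, length, getVert]
    | succ i => simp [append, length, getVert, ih]

theorem getVert_of_length_le {a b : V} (p : G.Walk a b) (i : ℕ) (hi : p.length ≤ i) :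
    p.getVert i = b := by
  induction p generalizing i with
  | nil => rfl
  | cons h p ih =>
    cases i with
    | zero => simp [length] at hi
    | succ i => exact ih i (by simpa [length] using hi)

theorem getVert_reverse {a b : V} (p : G.Walk a b) (i : ℕ) (hi : i ≤ p.length) :
    p.reverse.getVert i = p.getVert (p.length - i) := by
  induction p generalizing i with
  | nil => rfl
  | cons h p ih =>
    simp only [reverse, getVert_append, length_reverse, length]
    simp only [length] at hi
    split_ifs with hlt
    · rw [ih i hlt.le, show p.length + 1 - i = (p.length - i) + 1 by omega]
      rfl
    · rcases Nat.eq_or_lt_of_le hi with h1 | h1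
      · subst h1
        simp [edge, getVert]
      · have h2 : i = p.length := by omega
        subst h2
        simp [edge, getVert, getVert_zero]

theorem RelHomotopic.cons {a b c : V} (h : G.Adj a b) {p q : G.Walk b c} (H : RelHomotopic p q) :
    RelHomotopic (Walk.cons h p) (Walk.cons h q) := by
  obtain ⟨n, m, hp, hq, F, h0, h1, hl, hr⟩ := H
  refine ⟨n + 1, m, by simp [length, hp], by simp [length, hq],
    ⟨fun x => Fin.cases (motive := fun _ => V) a (fun i => F.toFun (i, x.2)) x.1, ?_⟩,
    ?_, ?_, ?_, ?_⟩
  · rintro ⟨i, j⟩ ⟨i', j'⟩ ⟨hi, hj⟩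
    cases i using Fin.cases with
    | zero =>
      cases i' using Fin.cases with
      | zero => simp [path] at hi
      | succ i' =>
        have : i' = 0 := by
          apply Fin.ext
          simpa [path] using hi
        subst this
        change G.Adj a (F.toFun (0, j'))
        rw [hl]
        exact h
    | succ i =>
      cases i' using Fin.cases with
      | zero =>
        have : i = 0 := by
          apply Fin.ext
          simpa [path] using hi
        subst this
        change G.Adj (F.toFun (0, j)) a
        rw [hl]
        exact G.symm h
      | succ i' =>
        refine F.map_adj (a := (i, j)) (b := (i', j')) ⟨?_, hj⟩
        simpa [path] using hi
  · intro i
    cases i using Fin.cases with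
    | zero => simp [getVert]
    | succ i => simp [getVert, h0]
  · intro i
    cases i using Fin.cases with
    | zero => simp [getVert]
    | succ i => simp [getVert, h1]
  · intro j
    simp
  · intro j
    simp [← Fin.succ_last, hr]

theorem RelHomotopic.reverse {a b : V} {p q : G.Walk a b} (H : RelHomotopic p q) :
    RelHomotopic p.reverse q.reverse := by
  obtain ⟨n, m, hp, hq, F, h0, h1, hl, hr⟩ := H
  refine ⟨n, m, by rw [length_reverse, hp], by rw [length_reverse, hq],
    ⟨fun x => F.toFun (x.1.rev, x.2), ?_⟩, ?_, ?_, ?_, ?_⟩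
  · rintro ⟨i, j⟩ ⟨i', j'⟩ ⟨hi, hj⟩
    refine F.map_adj ⟨?_, hj⟩
    simp only [path, Fin.val_rev] at hi ⊢
    omega
  · intro i
    rw [getVert_reverse _ _ (by omega)]
    simp only [h0, Fin.val_rev]
    congr 1
    omega
  · intro i
    rw [getVert_reverse _ _ (by omega)]
    simp only [h1, Fin.val_rev]
    congr 1
    omega
  · intro j
    simp [hr]
  · intro j
    simp [hl]

theorem Prune.reverse {a b : V} {p q : G.Walk a b} (H : Prune p q) :
    Prune p.reverse q.reverse := by
  cases H with
  | mk p h h' q =>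
    have := Prune.mk q.reverse (G.symm h') (G.symm h) p.reverse
    simpa [reverse_append, Walk.reverse, edge, append_assoc, append] using this

theorem Move.reverse {a b : V} {p q : G.Walk a b} (H : Move p q) : Move p.reverse q.reverse :=
  H.imp RelHomotopic.reverse Prune.reverse

theorem Move.append_left {a b c : V} (r : G.Walk a b) {p q : G.Walk b c} (H : Move p q) :
    Move (r.append p) (r.append q) := by
  refine H.imp (fun H => ?_) (fun H => ?_)
  · induction r with
    | nil => exact H
    | cons h r ih => exact (ih (Or.inl H) H).cons h
  · cases H with
    | mk p h h' q =>
      rw [← append_assoc, ← append_assoc]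
      exact Prune.mk _ _ _ _

theorem Move.append_right {a b c : V} {p q : G.Walk a b} (H : Move p q) (r : G.Walk b c) :
    Move (p.append r) (q.append r) := by
  have := (H.reverse.append_left r.reverse).reverse
  simpa [reverse_append, reverse_reverse] using this

end Walk

/-- Classes of walks from `a` to `b` under the equivalence relation generated by homotopy rel
endpoints and prunes. -/
def WalkClass (G : Gph V) (a b : V) : Type u := Quot (Walk.Move (G := G) (a := a) (b := b))

/-- The objects of the fundamental groupoid `Π(G)`: the vertices of `G`. -/
def FundGroupoid (_G : Gph V) : Type u := V

theorem mk_append_reverse {G : Gph V} {a b : V} (p : G.Walk a b) :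
    Quot.mk (Walk.Move (G := G)) (p.append p.reverse) = Quot.mk _ (Walk.nil a) := by
  induction p with
  | nil => rfl
  | @cons a b c h p ih =>
    have h1 : (Walk.cons h p).append (Walk.cons h p).reverse =
        ((Walk.edge h).append (p.append p.reverse)).append (Walk.edge (G.symm h)) := by
      simp [Walk.append, Walk.reverse, Walk.edge, Walk.append_assoc]
    rw [h1]
    have h2 := congrArg (Quot.map (fun q : G.Walk b b =>
      ((Walk.edge h).append q).append (Walk.edge (G.symm h)))
      (rb := Walk.Move) (fun _ _ H => (H.append_left _).append_right _)) ih
    refine Eq.trans h2 (Quot.sound (Or.inr ?_))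
    exact Walk.Prune.mk (Walk.nil a) h (G.symm h) (Walk.nil a)

theorem mk_reverse_append {G : Gph V} {a b : V} (p : G.Walk a b) :
    Quot.mk (Walk.Move (G := G)) (p.reverse.append p) = Quot.mk _ (Walk.nil b) := by
  have := mk_append_reverse p.reverse
  rwa [Walk.reverse_reverse] at this

/-- The fundamental groupoid `Π(G)`: arrows are classes of walks, composition is concatenation. -/
instance fundGroupoid (G : Gph V) : Groupoid (FundGroupoid G) where
  Hom a b := WalkClass G a b
  id a := Quot.mk _ (Walk.nil a)
  comp f g := Quot.map₂ Walk.append (fun r _ _ H => H.append_left r)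
    (fun _ _ r H => H.append_right r) f g
  id_comp f := by
    induction f using Quot.ind
    rfl
  comp_id f := by
    induction f using Quot.ind
    exact congrArg (Quot.mk _) (Walk.append_nil _)
  assoc f g h := by
    induction f using Quot.ind
    induction g using Quot.ind
    induction h using Quot.ind
    exact congrArg (Quot.mk _) (Walk.append_assoc _ _ _)
  inv f := Quot.map Walk.reverse (fun _ _ H => H.reverse) f
  inv_comp f := by
    induction f using Quot.ind with
    | mk p => exact mk_reverse_append p
  comp_inv f := by
    induction f using Quot.ind
    exact mk_append_reverse _

/-- The fundamental group `Π_v^v(G)`: the isotropy group of the fundamental groupoid at `v`. -/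
def FundGroup (G : Gph V) (v : V) : Type u := @Quiver.Hom (FundGroupoid G) _ v v

/-- The group structure given by composition of arrows (concatenation of closed walks). -/
instance (G : Gph V) (v : V) : Group (FundGroup G v) :=
  Groupoid.vertexGroup (C := FundGroupoid G) v

/-- The element of the fundamental group represented by a closed walk. -/
def Walk.toGroup {G : Gph V} {v : V} (p : G.Walk v v) : FundGroup G v :=
  Quot.mk (Walk.Move (G := G)) p

/-- The vertices of the Kneser graph `K(n, k)`: the `k`-element subsets of `{1, …, n}`. -/
abbrev KneserVertex (n k : ℕ) : Type := {s : Finset ℕ // s ⊆ Finset.Icc 1 n ∧ s.card = k}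

/-- The Kneser graph `K(n, k)`: vertices are adjacent when they are disjoint. -/
def kneser (n k : ℕ) : Gph (KneserVertex n k) where
  Adj s t := Disjoint s.val t.val
  symm h := h.symm

/-- The vertex `{a, b}` of `K(n, 2)`, for distinct `a, b` between `1` and `5`, where `n ≥ 6`. -/
def pair {n : ℕ} (hn : 6 ≤ n) (a b : ℕ) (h : a ∈ Finset.Icc 1 5 ∧ b ∈ Finset.Icc 1 5 ∧ a ≠ b) :
    KneserVertex n 2 :=
  ⟨{a, b}, by
    obtain ⟨ha, hb, hab⟩ := h
    refine ⟨?_, Finset.card_pair hab⟩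
    intro x hx
    simp only [Finset.mem_insert, Finset.mem_singleton, Finset.mem_Icc] at *
    omega⟩

/-- The 5-cycle `({1,2} {3,4} {1,5} {2,3} {4,5} {1,2})` of the Petersen graph `K(5,2)`, regarded as a
closed walk in `K(n,2)`. -/
def petersenCycle {n : ℕ} (hn : 6 ≤ n) :
    (kneser n 2).Walk (pair hn 1 2 (by decide)) (pair hn 1 2 (by decide)) :=
  .cons (b := pair hn 3 4 (by decide)) (by simp [kneser, pair]) <|
  .cons (b := pair hn 1 5 (by decide)) (by simp [kneser, pair]) <|
  .cons (b := pair hn 2 3 (by decide)) (by simp [kneser, pair]) <|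
  .cons (b := pair hn 4 5 (by decide)) (by simp [kneser, pair]) <|
  .cons (by simp [kneser, pair]) (.nil _)

end Gph

/-! In `K(n, 2)` with `n ≥ 6` any two vertices have a common neighbour, since two pairs cover at
most four points. A homotopy can move the middle vertex of a two-step walk freely, so there is a
single class `[x y]` of two-step walks from `x` to `y`. Once `[x y][y z] = [x z]` holds for all
triples, every even walk collapses to a two-step walk, and the class of a walk is determined by its
ends and the parity of its length.

The composition law is a triangle-filling statement. It holds for triples with a common neighbour
(`twoStepComp_of_common`), and a triangle can be filled once the other three faces of a tetrahedron
on it are (`TwoStepComp.of_insert`). Two such subdivisions reduce any triple of pairs to triples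
inside a four-element set, which have a common neighbour.

Conversely, parity is invariant under the moves, and 3-cycles are odd. Hence parity identifies the
group with `ZMod 2`, and the remaining claims are counts of lengths mod 2. -/

namespace Gph

namespace Walk

variable {V : Type u} {G : Gph V}

/-- Two walks representing the same arrow of the fundamental groupoid. -/
def Equivalent {a b : V} (p q : G.Walk a b) : Prop :=
  Quot.mk (Move (G := G)) p = Quot.mk _ q

namespace Equivalent

theorem refl {a b : V} (p : G.Walk a b) : Equivalent p p := Eq.refl _

theorem symm {a b : V} {p q : G.Walk a b} (h : Equivalent p q) : Equivalent q p := Eq.symm h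

theorem trans {a b : V} {p q r : G.Walk a b} (h : Equivalent p q) (h' : Equivalent q r) :
    Equivalent p r := Eq.trans h h'

theorem append {a b c : V} {p p' : G.Walk a b} {q q' : G.Walk b c} (h : Equivalent p p')
    (h' : Equivalent q q') : Equivalent (p.append q) (p'.append q') := by
  have h1 := congrArg (Quot.map (fun r : G.Walk a b => r.append q)
    (rb := Move) (fun _ _ H => H.append_right q)) h
  have h2 := congrArg (Quot.map (fun r : G.Walk b c => p'.append r)
    (rb := Move) (fun _ _ H => H.append_left p')) h'
  exact Eq.trans h1 h2

theorem append_left_cancel {a b c : V} (r : G.Walk a b) {p q : G.Walk b c}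
    (h : Equivalent (r.append p) (r.append q)) : Equivalent p q := by
  have key (s : G.Walk b c) : Equivalent (r.reverse.append (r.append s)) s := by
    rw [← append_assoc]
    exact append (p' := nil b) (mk_reverse_append r) (refl s)
  exact (key p).symm.trans ((append (refl r.reverse) h).trans (key q))

end Equivalent

/-! ### Two-step walks and their composition -/

/-- The walk of length two from `x` to `y` through `w`. -/
def via {x w y : V} (h : G.Adj x w) (h' : G.Adj w y) : G.Walk x y := cons h (cons h' (nil y))

theorem equivalent_via {x w w' y : V} (h₁ : G.Adj x w) (h₂ : G.Adj w y) (h₁' : G.Adj x w')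
    (h₂' : G.Adj w' y) : Equivalent (via h₁ h₂) (via h₁' h₂') := by
  -- One time step suffices: the path factor has no loops, so the old and new middle vertices need
  -- not be adjacent.
  refine Quot.sound (Or.inl ⟨2, 1, rfl, rfl,
    ⟨fun i => if i.2 = 0 then (via h₁ h₂).getVert i.1 else (via h₁' h₂').getVert i.1, ?_⟩,
    fun i => by simp, fun i => by simp, fun j => by simp [getVert_zero], fun j => ?_⟩)
  · have := G.symm h₁
    have := G.symm h₂
    have := G.symm h₁'
    have := G.symm h₂'
    rintro ⟨i, j⟩ ⟨i', j'⟩ ⟨hi, -⟩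
    fin_cases i <;> fin_cases i' <;> simp [path] at hi <;> fin_cases j <;> fin_cases j' <;>
      simpa [via, getVert]
  · simp [via, getVert]

theorem equivalent_via_self {x w : V} (h : G.Adj x w) (h' : G.Adj w x) :
    Equivalent (via h h') (nil x) :=
  Quot.sound (Or.inr (Prune.mk (nil x) h h' (nil x)))

/-- All concatenations of a walk of length two from `x` to `y` and one from `y` to `z` are equivalent
to all walks of length two from `x` to `z`. -/
def TwoStepComp (G : Gph V) (x y z : V) : Prop :=
  ∀ ⦃a b c : V⦄ (h₁ : G.Adj x a) (h₂ : G.Adj a y) (h₃ : G.Adj y b) (h₄ : G.Adj b z)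
    (h₅ : G.Adj x c) (h₆ : G.Adj c z),
    Equivalent ((via h₁ h₂).append (via h₃ h₄)) (via h₅ h₆)

/-- Routing both two-step walks through `w` gives `x w y w z`, and the detour `w y w` prunes away.
-/
theorem twoStepComp_of_common {x y z w : V} (hx : G.Adj x w) (hy : G.Adj y w) (hz : G.Adj z w) :
    TwoStepComp G x y z := fun _ _ _ h₁ h₂ h₃ h₄ h₅ h₆ =>
  ((equivalent_via h₁ h₂ hx (G.symm hy)).append (equivalent_via h₃ h₄ hy (G.symm hz))).trans <|
    Equivalent.trans
      (Quot.sound (Or.inr (Prune.mk (edge hx) (G.symm hy) hy (edge (G.symm hz)))))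
      (equivalent_via hx (G.symm hz) h₅ h₆)

/-- With all faces through `u` filled except `x y z`, one has `[x y][y z] = [x u][u y][y z] = [x
u][u z] = [x z]`. -/
theorem TwoStepComp.of_insert {x y z u : V} (hG : ∀ a b : V, ∃ w, G.Adj a w ∧ G.Adj b w)
    (h₁ : TwoStepComp G x u y) (h₂ : TwoStepComp G u y z) (h₃ : TwoStepComp G x u z) :
    TwoStepComp G x y z := by
  intro a b c k₁ k₂ k₃ k₄ k₅ k₆
  obtain ⟨d, hxd, hud⟩ := hG x u
  obtain ⟨e, hue, hye⟩ := hG u y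
  obtain ⟨f, huf, hzf⟩ := hG u z
  have e₁ := (h₁ hxd (G.symm hud) hue (G.symm hye) k₁ k₂).symm.append
    (Equivalent.refl (via k₃ k₄))
  rw [append_assoc] at e₁
  exact e₁.trans (((Equivalent.refl _).append
    (h₂ hue (G.symm hye) k₃ k₄ huf (G.symm hzf))).trans (h₃ _ _ _ _ k₅ k₆))

/-- The walk is peeled two edges at a time: the tail becomes a two-step walk through a common
neighbour of its ends and is then absorbed by the composition law. -/
theorem equivalent_via_of_even (hG : ∀ a b : V, ∃ w, G.Adj a w ∧ G.Adj b w)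
    (hT : ∀ x y z : V, TwoStepComp G x y z) : ∀ {a b w : V} (h : G.Adj a w) (h' : G.Adj w b)
    (p : G.Walk a b), Even p.length → Equivalent p (via h h')
  | _, _, _, h, h', nil _, _ => (equivalent_via_self h h').symm
  | _, _, _, _, _, cons _ (nil _), hp => by simp [length] at hp
  | _, b, _, h, h', cons k (cons (b := c) k' q), hp => by
    obtain ⟨e, hce, hbe⟩ := hG c b
    have hq : Even q.length := by
      simp only [length] at hp
      rw [Nat.even_iff] at hp ⊢
      omega
    exact Equivalent.trans ((Equivalent.refl (via k k')).append
      (equivalent_via_of_even hG hT hce (G.symm hbe) q hq)) (hT _ _ _ _ _ _ _ h h')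

/-- When two-step walks compose, a walk is determined up to equivalence by the parity of its length. -/
theorem equivalent_of_parity (hG : ∀ a b : V, ∃ w, G.Adj a w ∧ G.Adj b w)
    (hT : ∀ x y z : V, TwoStepComp G x y z) {a b : V} (p q : G.Walk a b)
    (h : p.length % 2 = q.length % 2) : Equivalent p q := by
  -- Both `p⁻¹ p` and `p⁻¹ q` are even closed walks at `b`, hence equivalent to the same backtrack
  -- at `b`.
  refine Equivalent.append_left_cancel p.reverse ?_
  obtain ⟨w, hw, -⟩ := hG b b
  have key (r : G.Walk a b) (hr : p.length % 2 = r.length % 2) :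
      Equivalent (p.reverse.append r) (via hw (G.symm hw)) := by
    refine equivalent_via_of_even hG hT _ _ _ ?_
    rw [length_append, length_reverse, Nat.even_iff]
    omega
  exact (key p rfl).trans (key q h).symm

/-- Homotopies preserve length and a prune lowers it by two. -/
theorem Move.length_parity {a b : V} {p q : G.Walk a b} (H : Move p q) :
    (p.length : ZMod 2) = q.length := by
  rcases H with ⟨n, m, hp, hq, -⟩ | H
  · rw [hp, hq]
  · cases H with
    | mk p h h' q =>
      simp only [length_append, length]
      push_cast
      linear_combination (CharTwo.two_eq_zero : (2 : ZMod 2) = 0)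

end Walk

open Walk

/-! ### The parity homomorphism -/

/-- The parity of the length of a closed walk, as a homomorphism from the fundamental group. -/
def lengthParity {V : Type u} (G : Gph V) (v : V) : FundGroup G v →* Multiplicative (ZMod 2) :=
  MonoidHom.mk' (Quot.lift (fun p : G.Walk v v => Multiplicative.ofAdd (p.length : ZMod 2))
    (fun _ _ H => congrArg _ H.length_parity)) (by
      intro f g
      induction f using Quot.ind with
      | mk p =>
        induction g using Quot.ind with
        | mk q =>
          change Multiplicative.ofAdd ((p.append q).length : ZMod 2) = _
          rw [length_append, Nat.cast_add]
          rfl)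

theorem lengthParity_toGroup {V : Type u} {G : Gph V} {v : V} (p : G.Walk v v) :
    lengthParity G v p.toGroup = Multiplicative.ofAdd (p.length : ZMod 2) := rfl

theorem exists_toGroup_eq {V : Type u} {G : Gph V} {v : V} (g : FundGroup G v) :
    ∃ p : G.Walk v v, p.toGroup = g := Quot.exists_rep g

/-! ### Filling triangles in the Kneser graph -/

section Kneser

variable {n : ℕ}

theorem exists_kneserVertex_disjoint (hn : 6 ≤ n) (s : Finset ℕ) (hs : s.card ≤ 4) :
    ∃ w : KneserVertex n 2, Disjoint s w.val := by
  have hcard : 2 ≤ (Finset.Icc 1 n \ s).card := by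
    have := Finset.le_card_sdiff s (Finset.Icc 1 n)
    rw [Nat.card_Icc] at this
    omega
  obtain ⟨w, hw, hw2⟩ := Finset.exists_subset_card_eq hcard
  exact ⟨⟨w, hw.trans Finset.sdiff_subset, hw2⟩,
    Finset.disjoint_of_subset_right hw Finset.disjoint_sdiff⟩

theorem kneser_exists_common (hn : 6 ≤ n) (x y : KneserVertex n 2) :
    ∃ w, (kneser n 2).Adj x w ∧ (kneser n 2).Adj y w := by
  obtain ⟨w, hw⟩ := exists_kneserVertex_disjoint hn (x.val ∪ y.val)
    ((Finset.card_union_le _ _).trans (by rw [x.2.2, y.2.2]))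
  exact ⟨w, Finset.disjoint_union_left.mp hw⟩

theorem twoStepComp_of_subset (hn : 6 ≤ n) {x y z : KneserVertex n 2} (a b c d : ℕ)
    (hx : x.val ⊆ {a, b, c, d}) (hy : y.val ⊆ {a, b, c, d}) (hz : z.val ⊆ {a, b, c, d}) :
    TwoStepComp (kneser n 2) x y z := by
  obtain ⟨w, hw⟩ := exists_kneserVertex_disjoint hn {a, b, c, d} Finset.card_le_four
  exact twoStepComp_of_common (w := w) (Finset.disjoint_of_subset_left hx hw)
    (Finset.disjoint_of_subset_left hy hw) (Finset.disjoint_of_subset_left hz hw)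

theorem exists_kneserVertex_pair {x y : KneserVertex n 2} {a b : ℕ} (ha : a ∈ x.val)
    (hb : b ∈ y.val) (hab : a ≠ b) : ∃ u : KneserVertex n 2, u.val = {a, b} :=
  ⟨⟨{a, b}, Finset.insert_subset (x.2.1 ha) (Finset.singleton_subset_iff.mpr (y.2.1 hb)),
    Finset.card_pair hab⟩, rfl⟩

theorem exists_eq_pair_of_mem {x : KneserVertex n 2} {a : ℕ} (ha : a ∈ x.val) :
    ∃ b, x.val = {a, b} := by
  obtain ⟨c, d, -, h⟩ := Finset.card_eq_two.mp x.2.2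
  rw [h, Finset.mem_insert, Finset.mem_singleton] at ha
  rcases ha with rfl | rfl
  · exact ⟨d, h⟩
  · exact ⟨c, by rw [h, Finset.pair_comm]⟩

theorem exists_eq_pair_ne (x : KneserVertex n 2) (a : ℕ) :
    ∃ p c, p ≠ a ∧ x.val = {p, c} := by
  obtain ⟨c, d, hcd, h⟩ := Finset.card_eq_two.mp x.2.2
  by_cases hc : c = a
  · exact ⟨d, c, hc ▸ hcd.symm, by rw [h, Finset.pair_comm]⟩
  · exact ⟨c, d, hc, h⟩

/-- Let `{q, a}` and `{q, b}` be the two vertices sharing `q`, and `{p, c}` the third, with `p ≠ q`.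
Inserting `u = {q, p}` leaves three faces, contained in `{q, p, a, b}`, `{q, p, a, c}` and `{q, p,
b, c}`. -/
theorem twoStepComp_of_mem (hn : 6 ≤ n) {x y z : KneserVertex n 2} {q : ℕ}
    (h : q ∈ x.val ∧ q ∈ y.val ∨ q ∈ y.val ∧ q ∈ z.val ∨ q ∈ x.val ∧ q ∈ z.val) :
    TwoStepComp (kneser n 2) x y z := by
  rcases h with ⟨h, h'⟩ | ⟨h, h'⟩ | ⟨h, h'⟩
  on_goal 1 => obtain ⟨p, c, hpq, hp⟩ := exists_eq_pair_ne z q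
  on_goal 2 => obtain ⟨p, c, hpq, hp⟩ := exists_eq_pair_ne x q
  on_goal 3 => obtain ⟨p, c, hpq, hp⟩ := exists_eq_pair_ne y q
  all_goals
    obtain ⟨u, hu⟩ := exists_kneserVertex_pair (a := p) (by rw [hp]; simp) h hpq
    obtain ⟨a, ha⟩ := exists_eq_pair_of_mem h
    obtain ⟨b, hb⟩ := exists_eq_pair_of_mem h'
  · exact .of_insert (u := u) (kneser_exists_common hn)
      (twoStepComp_of_subset hn q p a b (by grind) (by grind) (by grind))
      (twoStepComp_of_subset hn q p b c (by grind) (by grind) (by grind))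
      (twoStepComp_of_subset hn q p a c (by grind) (by grind) (by grind))
  · exact .of_insert (u := u) (kneser_exists_common hn)
      (twoStepComp_of_subset hn q p a c (by grind) (by grind) (by grind))
      (twoStepComp_of_subset hn q p a b (by grind) (by grind) (by grind))
      (twoStepComp_of_subset hn q p b c (by grind) (by grind) (by grind))
  · exact .of_insert (u := u) (kneser_exists_common hn)
      (twoStepComp_of_subset hn q p a c (by grind) (by grind) (by grind))
      (twoStepComp_of_subset hn q p b c (by grind) (by grind) (by grind))
      (twoStepComp_of_subset hn q p a b (by grind) (by grind) (by grind))

theorem kneser_twoStepComp (hn : 6 ≤ n) (x y z : KneserVertex n 2) :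
    TwoStepComp (kneser n 2) x y z := by
  obtain ⟨p, hp⟩ : x.val.Nonempty := Finset.card_pos.mp (by rw [x.2.2]; norm_num)
  obtain ⟨q, hq⟩ : y.val.Nonempty := Finset.card_pos.mp (by rw [y.2.2]; norm_num)
  by_cases hpq : p = q
  · exact twoStepComp_of_mem hn (Or.inl ⟨hp, hpq ▸ hq⟩)
  -- The inserted vertex `u = {p, q}` meets both `x` and `y`, so each of the three new faces has two
  -- vertices with a common element.
  · obtain ⟨u, hu⟩ := exists_kneserVertex_pair hp hq hpq
    have hpu : p ∈ u.val := by simp [hu]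
    have hqu : q ∈ u.val := by simp [hu]
    exact .of_insert (kneser_exists_common hn) (twoStepComp_of_mem hn (Or.inl ⟨hp, hpu⟩))
      (twoStepComp_of_mem hn (Or.inl ⟨hqu, hq⟩)) (twoStepComp_of_mem hn (Or.inl ⟨hp, hpu⟩))

/-- In `K(n, 2)`, walks with the same ends are equivalent when their lengths have the same parity. -/
theorem kneser_equivalent (hn : 6 ≤ n) {x y : KneserVertex n 2} (p q : (kneser n 2).Walk x y)
    (h : p.length % 2 = q.length % 2) : Equivalent p q :=
  equivalent_of_parity (kneser_exists_common hn) (kneser_twoStepComp hn) p q h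

/-! ### 3-cycles and the group of order two -/

theorem kneser_ne_of_adj {x y : KneserVertex n 2} (h : (kneser n 2).Adj x y) : x ≠ y := by
  rintro rfl
  have h2 := x.2.2
  have h0 : x.val = ∅ := disjoint_self.mp h
  simp [h0] at h2

theorem kneser_exists_threeCycle (hn : 6 ≤ n) (v : KneserVertex n 2) :
    ∃ C : (kneser n 2).Walk v v, C.IsThreeCycle := by
  obtain ⟨w, hw, -⟩ := kneser_exists_common hn v v
  obtain ⟨x, hx, hx'⟩ := kneser_exists_common hn v w
  exact ⟨cons hw (cons hx' (cons ((kneser n 2).symm hx) (nil v))), rfl, kneser_ne_of_adj hw,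
    kneser_ne_of_adj hx, kneser_ne_of_adj hx'⟩

theorem kneser_toGroup_eq_one_or (hn : 6 ≤ n) {v : KneserVertex n 2} {C : (kneser n 2).Walk v v}
    (hC : C.IsThreeCycle) (g : FundGroup (kneser n 2) v) : g = 1 ∨ g = C.toGroup := by
  obtain ⟨p, rfl⟩ := exists_toGroup_eq g
  rcases Nat.mod_two_eq_zero_or_one p.length with h | h
  · exact Or.inl (kneser_equivalent hn p (nil v) h)
  · exact Or.inr (kneser_equivalent hn p C (by rw [h, hC.1]))

theorem kneser_lengthParity_bijective (hn : 6 ≤ n) (v : KneserVertex n 2) :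
    Function.Bijective (lengthParity (kneser n 2) v) := by
  obtain ⟨C, hC⟩ := kneser_exists_threeCycle hn v
  have hC1 : lengthParity (kneser n 2) v C.toGroup = Multiplicative.ofAdd 1 := by
    rw [lengthParity_toGroup, hC.1]
    rfl
  constructor
  · rw [injective_iff_map_eq_one]
    intro g hg
    rcases kneser_toGroup_eq_one_or hn hC g with h | rfl
    · exact h
    · rw [hC1] at hg
      exact absurd hg (by decide)
  · intro z
    have hz : z = 1 ∨ z = Multiplicative.ofAdd 1 := by
      revert z
      decide
    rcases hz with rfl | rfl
    · exact ⟨1, map_one _⟩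
    · exact ⟨_, hC1⟩

theorem kneser_closure_eq_top (hn : 6 ≤ n) {v : KneserVertex n 2} {C : (kneser n 2).Walk v v}
    (hC : C.IsThreeCycle) {S : Set (FundGroup (kneser n 2) v)} (hS : C.toGroup ∈ S) :
    Subgroup.closure S = ⊤ := by
  rw [eq_top_iff]
  intro g _
  rcases kneser_toGroup_eq_one_or hn hC g with rfl | rfl
  · exact one_mem _
  · exact Subgroup.subset_closure hS

end Kneser

end Gph

theorem mainTheorem9 (n : ℕ) (hn : 6 ≤ n) :
    -- The statements about an arbitrary basepoint `v`.
    (∀ v : Gph.KneserVertex n 2,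
      -- The fundamental group is cyclic of order two.
      Nonempty (Gph.FundGroup (Gph.kneser n 2) v ≃* Multiplicative (ZMod 2)) ∧
      -- It is generated by the circuits `P C P⁻¹` with `C` a 3-cycle.
      Subgroup.closure {g : Gph.FundGroup (Gph.kneser n 2) v |
        ∃ (x : Gph.KneserVertex n 2) (P : (Gph.kneser n 2).Walk v x)
          (C : (Gph.kneser n 2).Walk x x), C.IsThreeCycle ∧
          g = ((P.append C).append P.reverse).toGroup} = ⊤ ∧
      -- The walk `P` can be shortened by its last edge.
      (∀ (y x : Gph.KneserVertex n 2) (Q : (Gph.kneser n 2).Walk v y)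
          (h : (Gph.kneser n 2).Adj y x) (C : (Gph.kneser n 2).Walk x x), C.IsThreeCycle →
          ∃ C' : (Gph.kneser n 2).Walk y y, C'.IsThreeCycle ∧
            (((Q.append (Gph.Walk.edge h)).append C).append
                (Q.append (Gph.Walk.edge h)).reverse).toGroup =
              ((Q.append C').append Q.reverse).toGroup) ∧
      -- It is generated by the 3-cycles through the basepoint.
      Subgroup.closure {g : Gph.FundGroup (Gph.kneser n 2) v |
        ∃ C : (Gph.kneser n 2).Walk v v, C.IsThreeCycle ∧ g = C.toGroup} = ⊤) ∧
    -- At the basepoint `{1, 2}` all 3-cycles are equal to the 5-cycle `β`, and `β = β⁻¹`.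
    (∀ C : (Gph.kneser n 2).Walk (Gph.pair hn 1 2 (by decide)) (Gph.pair hn 1 2 (by decide)),
      C.IsThreeCycle → C.toGroup = (Gph.petersenCycle hn).toGroup) ∧
    (Gph.petersenCycle hn).toGroup = (Gph.petersenCycle hn).toGroup⁻¹ := by
  refine ⟨fun v => ?_, fun C hC => ?_, ?_⟩
  · obtain ⟨C, hC⟩ := Gph.kneser_exists_threeCycle hn v
    refine ⟨⟨MulEquiv.ofBijective _ (Gph.kneser_lengthParity_bijective hn v)⟩,
      Gph.kneser_closure_eq_top hn hC ⟨v, .nil v, C, hC, ?_⟩, ?_,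
      Gph.kneser_closure_eq_top hn hC ⟨C, hC, rfl⟩⟩
    · exact congrArg Gph.Walk.toGroup (Gph.Walk.append_nil C).symm
    · intro y x Q h C hC
      -- Any 3-cycle at `y` will do: both circuits have odd length.
      obtain ⟨C', hC'⟩ := Gph.kneser_exists_threeCycle hn y
      refine ⟨C', hC', Gph.kneser_equivalent hn _ _ ?_⟩
      simp only [Gph.Walk.length_append, Gph.Walk.length_reverse, hC.1, hC'.1]
      omega
  · exact Gph.kneser_equivalent hn _ _ (by
      simp [hC.1, Gph.petersenCycle, Gph.Walk.length])
  -- By definition the inverse is represented by the reversed walk, which has the same length.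
  · exact Gph.kneser_equivalent hn _ (Gph.petersenCycle hn).reverse
      (by rw [Gph.Walk.length_reverse])
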